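/- Let $(S,\mathcal S)$ be a non-empty measurable space, let $(X_n)_{n\ge 0}$ be a homogeneous Markov chain on $S$ with one-step transition kernel $P$ and $n$-step transition probabilities $P_x(n,\cdot)$, and let $m\ge 1$. For $x=(x^1,x^2)\in S^2=S\times S$ put $\Lambda_x=P_{x^1}(m,\cdot)+P_{x^2}(m,\cdot)$, let $p(x^i,\cdot)$ be the density of $P_{x^i}(m,\cdot)$ with respect to $\Lambda_x$, and let $$\alpha(x)=\int p(x^1,u)\wedge p(x^2,u)\,\Lambda_x(du).$$ If $\alpha(x)<1$, let $\varphi_i(x,\cdot)$ $(i=1,2)$ be the probability measure with density $\big(p(x^i,u)-p(x^1,u)\wedge p(x^2,u)\big)/(1-\alpha(x))$ with respect to $\Lambda_x$; if $\alpha(x)=1$, put $\varphi_1(x,\cdot)=\varphi_2(x,\cdot)=P_{x^1}(m,\cdot)$. The operator $V^{(m)}$ acts on bounded measurable functions on $S^2$ (with the product $\sigma$-algebra) by $$V^{(m)}h(x)=(1-\alpha(x))\int_{S^2} h(y^1,y^2)\,\varphi_1(x,dy^1)\,\varphi_2(x,dy^2);$$ assume that $V^{(m)}h$ is measurable for every such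 $h$ (this is automatic if $\mathcal S$ is countably generated). Let $r(V^{(m)})$ be the spectral radius of $V^{(m)}$ on the Banach space of bounded measurable complex-valued functions on $S^2$ with the supremum norm. Let $\|\mu-\nu\|_{TV}$ denote the total variation norm of the signed measure $\mu-\nu$ (equal to $2\sup_A|\mu(A)-\nu(A)|$ for probability measures). Suppose that $r(V^{(m)})<1$. Then the chain has exactly one invariant probability measure $\mu$, and convergence to $\mu$ is exponential: for every initial distribution $\mu_0$ there are constants $C$ and $q\in[0,1)$ such that the law $\mu_n$ of $X_n$ satisfies $\|\mu_n-\mu\|_{TV}\le C q^n$ for all $n\ge 0$. Moreover, for every $x^1\in S$ and every $\varepsilon>0$ there is $N(x^1,\varepsilon)$ such that for all $n\ge N(x^1,\varepsilon)$ $$\|P_{x^1}(n,\cdot)-\mu\|_{TV}\le \big(r(V^{(m)})+\varepsilon\big)^{[n/m]}.$$ -/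

import Mathlib

open MeasureTheory ProbabilityTheory
open scoped ENNReal

noncomputable section

namespace MarkovCoupling

variable {S : Type*} [MeasurableSpace S]

/-- The total variation norm `‖μ - ν‖_TV` of the difference of two finite measures, that is,
the total mass of the variation of the signed measure `μ - ν`
(equal to `2 * sup_A |μ A - ν A|` for probability measures). -/
def tvNorm (μ ν : Measure S) [IsFiniteMeasure μ] [IsFiniteMeasure ν] : ℝ :=
  ((μ.toSignedMeasure - ν.toSignedMeasure).totalVariation Set.univ).toReal

/-! Below `Q` is a transition kernel on `S` (later: the `m`-step kernel of a Markov chain) and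
`x = (x.1, x.2)` is a pair of states. -/

/-- The dominating measure `Λ_x = Q(x.1, ·) + Q(x.2, ·)`. -/
def refMeasure (Q : Kernel S S) (x : S × S) : Measure S := Q x.1 + Q x.2

/-- The density of `Q(x.1, ·)` with respect to `Λ_x`. -/
def dens₁ (Q : Kernel S S) (x : S × S) : S → ℝ≥0∞ := (Q x.1).rnDeriv (refMeasure Q x)

/-- The density of `Q(x.2, ·)` with respect to `Λ_x`. -/
def dens₂ (Q : Kernel S S) (x : S × S) : S → ℝ≥0∞ := (Q x.2).rnDeriv (refMeasure Q x)

/-- The overlap `α(x.1, x.2) = ∫ p(x.1, y) ∧ p(x.2, y) Λ_x(dy)`. -/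
def overlap (Q : Kernel S S) (x : S × S) : ℝ≥0∞ :=
  ∫⁻ y, min (dens₁ Q x y) (dens₂ Q x y) ∂(refMeasure Q x)

open Classical in
/-- Law of the first component after one step, given that the coupling did not succeed: density
`(p(x.1, u) - p(x.1, u) ∧ p(x.2, u)) / (1 - α(x))` with respect to `Λ_x`.
In the degenerate case `α(x) = 1` it is `Q(x.1, ·)`, by convention. -/
def residual₁ (Q : Kernel S S) (x : S × S) : Measure S :=
  if overlap Q x = 1 then Q x.1
  else (refMeasure Q x).withDensity
    fun u => (dens₁ Q x u - min (dens₁ Q x u) (dens₂ Q x u)) / (1 - overlap Q x)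

open Classical in
/-- Law of the second component after one step, given that the coupling did not succeed: density
`(p(x.2, u) - p(x.1, u) ∧ p(x.2, u)) / (1 - α(x))` with respect to `Λ_x`.
In the degenerate case `α(x) = 1` it is `Q(x.1, ·)`, by convention. -/
def residual₂ (Q : Kernel S S) (x : S × S) : Measure S :=
  if overlap Q x = 1 then Q x.1
  else (refMeasure Q x).withDensity
    fun u => (dens₂ Q x u - min (dens₁ Q x u) (dens₂ Q x u)) / (1 - overlap Q x)

/-- `V h (x) = (1 - α(x)) E_x h(η¹, η²)`, where `η¹` and `η²` are independent with the laws
`residual₁ Q x` and `residual₂ Q x`: the expectation of `h` over the coupled pair after one step,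
restricted to the event that the coupling did not succeed. -/
def couplingFun (Q : Kernel S S) (h : S × S → ℂ) (x : S × S) : ℂ :=
  ((1 - overlap Q x).toReal : ℂ) * ∫ y, h y ∂((residual₁ Q x).prod (residual₂ Q x))

/-- `V` maps bounded measurable functions on `S × S` to measurable functions. -/
def PreservesMeasurability (Q : Kernel S S) : Prop :=
  ∀ h : S × S → ℂ, Measurable h → (∃ C : ℝ, ∀ x, ‖h x‖ ≤ C) → Measurable (couplingFun Q h)

/-- The space of bounded measurable functions `X → ℂ` with the supremum norm. -/
def BddMeas (X : Type*) [MeasurableSpace X] : Submodule ℂ (lp (fun _ : X => ℂ) ∞) where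
  carrier := {f | Measurable (fun x => f x)}
  add_mem' := fun {f g} hf hg => by
    exact Measurable.add hf hg
  zero_mem' := measurable_const (a := (0 : ℂ))
  smul_mem' := fun c f hf => by
    exact Measurable.const_mul hf c

/-- The function underlying an element of `BddMeas X`. -/
def toFun {X : Type*} [MeasurableSpace X] (f : BddMeas X) : X → ℂ := fun x => f.1 x

theorem norm_toFun_le {X : Type*} [MeasurableSpace X] (f : BddMeas X) (x : X) :
    ‖toFun f x‖ ≤ ‖f‖ :=
  lp.norm_apply_le_norm (by simp) f.1 x

instance isMarkovKernel_pow (P : Kernel S S) [IsMarkovKernel P] (n : ℕ) :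
    IsMarkovKernel (P ^ n) := by
  induction n with
  | zero => exact inferInstanceAs (IsMarkovKernel (Kernel.id : Kernel S S))
  | succ n ih => exact inferInstanceAs (IsMarkovKernel ((P ^ n) ∘ₖ P))

/-! Facts needed to see that `V` is a bounded operator. -/

section facts

variable (Q : Kernel S S) (x : S × S)

theorem measurable_dens₁ : Measurable (dens₁ Q x) := Measure.measurable_rnDeriv _ _

theorem measurable_dens₂ : Measurable (dens₂ Q x) := Measure.measurable_rnDeriv _ _

variable [IsMarkovKernel Q]

instance : IsFiniteMeasure (refMeasure Q x) := by unfold refMeasure; infer_instance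

theorem lintegral_dens₁ : ∫⁻ y, dens₁ Q x y ∂(refMeasure Q x) = 1 := by
  have h : Q x.1 ≪ refMeasure Q x := by
    unfold refMeasure
    exact Measure.AbsolutelyContinuous.add_right Measure.AbsolutelyContinuous.rfl _
  unfold dens₁
  rw [Measure.lintegral_rnDeriv h, measure_univ]

theorem lintegral_dens₂ : ∫⁻ y, dens₂ Q x y ∂(refMeasure Q x) = 1 := by
  have h : Q x.2 ≪ refMeasure Q x := by
    unfold refMeasure
    rw [add_comm]
    exact Measure.AbsolutelyContinuous.add_right Measure.AbsolutelyContinuous.rfl _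
  unfold dens₂
  rw [Measure.lintegral_rnDeriv h, measure_univ]

theorem overlap_le_one : overlap Q x ≤ 1 :=
  (lintegral_mono fun _ => min_le_left _ _).trans_eq (lintegral_dens₁ Q x)

instance : IsProbabilityMeasure (residual₁ Q x) := by
  unfold residual₁
  split_ifs with h
  · infer_instance
  · have h0 : 1 - overlap Q x ≠ 0 :=
      (tsub_pos_of_lt (lt_of_le_of_ne (overlap_le_one Q x) h)).ne'
    refine ⟨?_⟩
    rw [withDensity_apply _ MeasurableSet.univ, Measure.restrict_univ]
    simp_rw [div_eq_mul_inv]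
    rw [lintegral_mul_const' _ _ (ENNReal.inv_ne_top.2 h0),
      lintegral_sub ((measurable_dens₁ Q x).min (measurable_dens₂ Q x))
        (ne_top_of_le_ne_top ENNReal.one_ne_top (overlap_le_one Q x))
        (Filter.Eventually.of_forall fun _ => min_le_left _ _), lintegral_dens₁]
    exact ENNReal.mul_inv_cancel h0 (ENNReal.sub_ne_top ENNReal.one_ne_top)

instance : IsProbabilityMeasure (residual₂ Q x) := by
  unfold residual₂
  split_ifs with h
  · infer_instance
  · have h0 : 1 - overlap Q x ≠ 0 :=
      (tsub_pos_of_lt (lt_of_le_of_ne (overlap_le_one Q x) h)).ne'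
    refine ⟨?_⟩
    rw [withDensity_apply _ MeasurableSet.univ, Measure.restrict_univ]
    simp_rw [div_eq_mul_inv]
    rw [lintegral_mul_const' _ _ (ENNReal.inv_ne_top.2 h0),
      lintegral_sub ((measurable_dens₁ Q x).min (measurable_dens₂ Q x))
        (ne_top_of_le_ne_top ENNReal.one_ne_top (overlap_le_one Q x))
        (Filter.Eventually.of_forall fun _ => min_le_right _ _), lintegral_dens₂]
    exact ENNReal.mul_inv_cancel h0 (ENNReal.sub_ne_top ENNReal.one_ne_top)

variable {Q x}

theorem norm_couplingFun_le {h : S × S → ℂ} {C : ℝ} (hC : ∀ y, ‖h y‖ ≤ C) :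
    ‖couplingFun Q h x‖ ≤ C := by
  have h1 : ‖∫ y, h y ∂((residual₁ Q x).prod (residual₂ Q x))‖ ≤ C := by
    simpa using norm_integral_le_of_norm_le_const
      (μ := (residual₁ Q x).prod (residual₂ Q x)) (Filter.Eventually.of_forall hC)
  have h2 : (1 - overlap Q x).toReal ≤ 1 := by
    simpa using ENNReal.toReal_mono ENNReal.one_ne_top (tsub_le_self (a := 1) (b := overlap Q x))
  unfold couplingFun
  rw [norm_mul, Complex.norm_real, Real.norm_of_nonneg ENNReal.toReal_nonneg]
  calc _ ≤ 1 * C := mul_le_mul h2 h1 (norm_nonneg _) zero_le_one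
    _ = C := one_mul C

theorem integrable_toFun (f : BddMeas (S × S)) (μ : Measure (S × S)) [IsFiniteMeasure μ] :
    Integrable (toFun f) μ :=
  Integrable.of_bound (Measurable.aestronglyMeasurable f.2) ‖f‖
    (Filter.Eventually.of_forall (norm_toFun_le f))

end facts

/-- The operator `V` on the Banach space of bounded measurable (complex) functions on `S × S`. -/
def couplingOp (Q : Kernel S S) [IsMarkovKernel Q] (hQ : PreservesMeasurability Q) :
    BddMeas (S × S) →L[ℂ] BddMeas (S × S) :=
  LinearMap.mkContinuous
    { toFun := fun f =>
        ⟨⟨couplingFun Q (toFun f), memℓp_infty ⟨‖f‖, by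
          rintro _ ⟨x, rfl⟩
          exact norm_couplingFun_le (norm_toFun_le f)⟩⟩,
          hQ (toFun f) f.2 ⟨‖f‖, (norm_toFun_le f)⟩⟩
      map_add' := fun f g => by
        apply Subtype.ext
        apply Subtype.ext
        funext x
        change couplingFun Q (fun y => toFun f y + toFun g y) x
          = couplingFun Q (toFun f) x + couplingFun Q (toFun g) x
        unfold couplingFun
        rw [integral_add (integrable_toFun f _) (integrable_toFun g _), mul_add]
      map_smul' := fun c f => by
        apply Subtype.ext
        apply Subtype.ext
        funext x
        change couplingFun Q (fun y => c * toFun f y) x = c * couplingFun Q (toFun f) x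
        unfold couplingFun
        rw [integral_const_mul]
        ring }
    1 (fun f => by
      rw [one_mul]
      exact lp.norm_le_of_forall_le (norm_nonneg _)
        fun x => norm_couplingFun_le (norm_toFun_le f))

/-- If the sigma-algebra of `S` is countably generated, then `V` always preserves
measurability. -/
theorem preservesMeasurability_of_countablyGenerated [MeasurableSpace.CountablyGenerated S]
    (Q : Kernel S S) [IsMarkovKernel Q] : PreservesMeasurability Q := by
  let K₁ : Kernel (S × S) S := Q.comap Prod.fst measurable_fst
  let K₂ : Kernel (S × S) S := Q.comap Prod.snd measurable_snd
  let L : Kernel (S × S) S := K₁ + K₂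
  have hL : ∀ x, L x = refMeasure Q x := fun x => rfl
  let f₁ : S × S → S → ℝ≥0∞ := Kernel.rnDeriv K₁ L
  let f₂ : S × S → S → ℝ≥0∞ := Kernel.rnDeriv K₂ L
  have hf₁ : Measurable (Function.uncurry f₁) := Kernel.measurable_rnDeriv K₁ L
  have hf₂ : Measurable (Function.uncurry f₂) := Kernel.measurable_rnDeriv K₂ L
  have e₁ : ∀ x, f₁ x =ᵐ[refMeasure Q x] dens₁ Q x := fun x =>
    Kernel.rnDeriv_eq_rnDeriv_measure (κ := K₁) (η := L) (a := x)
  have e₂ : ∀ x, f₂ x =ᵐ[refMeasure Q x] dens₂ Q x := fun x =>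
    Kernel.rnDeriv_eq_rnDeriv_measure (κ := K₂) (η := L) (a := x)
  have hov : Measurable (overlap Q) := by
    have : overlap Q = fun x => ∫⁻ y, min (f₁ x y) (f₂ x y) ∂(L x) := by
      funext x
      refine lintegral_congr_ae ?_
      filter_upwards [e₁ x, e₂ x] with y h1 h2
      rw [h1, h2]
    rw [this]
    exact Measurable.lintegral_kernel_prod_right (hf₁.min hf₂)
  have hset : MeasurableSet {x | overlap Q x = 1} := hov (measurableSet_singleton 1)
  have hm : Measurable fun p : (S × S) × S => min (f₁ p.1 p.2) (f₂ p.1 p.2) := hf₁.min hf₂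
  have hm₁ : Measurable (residual₁ Q) := by
    classical
    unfold residual₁
    refine Measurable.ite hset (Q.measurable.comp measurable_fst) ?_
    refine Measure.measurable_of_measurable_coe _ fun s hs => ?_
    have : (fun x => ((refMeasure Q x).withDensity fun u =>
        (dens₁ Q x u - min (dens₁ Q x u) (dens₂ Q x u)) / (1 - overlap Q x)) s)
        = fun x => ∫⁻ u in s, (f₁ x u - min (f₁ x u) (f₂ x u)) / (1 - overlap Q x) ∂(L x) := by
      funext x
      rw [withDensity_apply _ hs]
      refine lintegral_congr_ae (ae_restrict_of_ae ?_)
      filter_upwards [e₁ x, e₂ x] with y h1 h2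
      rw [h1, h2]
    rw [this]
    exact Measurable.setLIntegral_kernel_prod_right
      ((Measurable.sub hf₁ hm).div (measurable_const.sub (hov.comp measurable_fst))) hs
  have hm₂ : Measurable (residual₂ Q) := by
    classical
    unfold residual₂
    refine Measurable.ite hset (Q.measurable.comp measurable_fst) ?_
    refine Measure.measurable_of_measurable_coe _ fun s hs => ?_
    have : (fun x => ((refMeasure Q x).withDensity fun u =>
        (dens₂ Q x u - min (dens₁ Q x u) (dens₂ Q x u)) / (1 - overlap Q x)) s)
        = fun x => ∫⁻ u in s, (f₂ x u - min (f₁ x u) (f₂ x u)) / (1 - overlap Q x) ∂(L x) := by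
      funext x
      rw [withDensity_apply _ hs]
      refine lintegral_congr_ae (ae_restrict_of_ae ?_)
      filter_upwards [e₁ x, e₂ x] with y h1 h2
      rw [h1, h2]
    rw [this]
    exact Measurable.setLIntegral_kernel_prod_right
      ((Measurable.sub hf₂ hm).div (measurable_const.sub (hov.comp measurable_fst))) hs
  intro h hh _
  let R₁ : Kernel (S × S) S := ⟨residual₁ Q, hm₁⟩
  let R₂ : Kernel (S × S) S := ⟨residual₂ Q, hm₂⟩
  have : IsMarkovKernel R₁ := ⟨fun x => inferInstanceAs (IsProbabilityMeasure (residual₁ Q x))⟩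
  have : IsMarkovKernel R₂ := ⟨fun x => inferInstanceAs (IsProbabilityMeasure (residual₂ Q x))⟩
  have hint : Measurable fun x => ∫ y, h y ∂((residual₁ Q x).prod (residual₂ Q x)) := by
    have : (fun x => ∫ y, h y ∂((residual₁ Q x).prod (residual₂ Q x)))
        = fun x => ∫ y, h y ∂((R₁ ×ₖ R₂) x) := by
      funext x
      rw [Kernel.prod_apply]
      rfl
    rw [this]
    exact (hh.stronglyMeasurable.integral_kernel).measurable
  exact (Complex.measurable_ofReal.comp (measurable_const.sub hov).ennreal_toReal).mul hint

end MarkovCoupling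

end

open Filter Topology

namespace MarkovCoupling

noncomputable section

variable {S : Type*} [MeasurableSpace S]

/-! ### Total variation and setwise distances -/

/-! No coupled chain has to be built. Write `Q = P ^ m`. On functions of the form `f y.1 - f y.2`
the operator `V` acts as `Q` does on `f`: the common part of `Q x.1` and `Q x.2` cancels, and the
expectation of such a difference depends only on the marginals (`couplingFun_sub`). Iterating,
`P^n(s, A) - P^n(t, A)` is the value at `(s, t)` of `V ^ (n / m)` applied to the difference function
of `(P ^ (n % m)) · A`, whose norm is at most 1. So it is bounded by `‖V ^ (n / m)‖`, and averaging
over `s` and `t` extends the bound to any two initial laws (`abs_real_pow_comp_sub_le`).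

Gelfand's formula turns `r(V) < 1` into geometric decay of this norm
(`eventually_norm_couplingOp_pow_le`, `exists_geometric_bound_div`). Forgetting the initial law
uniformly makes the laws from one point a setwise uniform Cauchy sequence; its limit is the unique
invariant probability measure (`existsUnique_invariant`). Passing from setwise distance to total
variation costs a factor 2, which `ε` absorbs. -/

theorem tvNorm_le_two_mul {μ ν : Measure S} [IsFiniteMeasure μ] [IsFiniteMeasure ν] {c : ℝ}
    (h : ∀ A, MeasurableSet A → |μ.real A - ν.real A| ≤ c) : tvNorm μ ν ≤ 2 * c := by
  unfold tvNorm
  -- On a Hahn decomposition `i`, `iᶜ`, the total mass is the difference on `i` minus the difference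
  -- on `iᶜ`.
  obtain ⟨i, hi, hpos, hneg, h1, h2⟩ :=
    (μ.toSignedMeasure - ν.toSignedMeasure).toJordanDecomposition_spec
  have e1 := SignedMeasure.toMeasureOfZeroLE_real_apply _ hpos hi MeasurableSet.univ
  have e2 := SignedMeasure.toMeasureOfLEZero_real_apply _ hneg hi.compl MeasurableSet.univ
  rw [← h1, Set.inter_univ, Measure.toSignedMeasure_sub_apply hi] at e1
  rw [← h2, Set.inter_univ, Measure.toSignedMeasure_sub_apply hi.compl] at e2
  rw [SignedMeasure.totalVariation, ← measureReal_def, measureReal_add_apply, e1, e2]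
  have b1 := abs_le.1 (h i hi)
  have b2 := abs_le.1 (h iᶜ hi.compl)
  linarith

/-- Probability measures that are setwise `c`-close have `c`-close integrals of functions with
values in `[0, 1]`. -/
theorem abs_integral_sub_integral_le {μ ν : Measure S} [IsProbabilityMeasure μ]
    [IsProbabilityMeasure ν] {c : ℝ} (h : ∀ A, MeasurableSet A → |μ.real A - ν.real A| ≤ c)
    {f : S → ℝ} (hf : Measurable f) (h0 : ∀ x, 0 ≤ f x) (h1 : ∀ x, f x ≤ 1) :
    |∫ x, f x ∂μ - ∫ x, f x ∂ν| ≤ c := by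
  -- Layer-cake formula: both integrals are averages over `t ∈ (0, 1]` of measures of superlevel
  -- sets, which are `c`-close.
  have key : ∀ (ρ : Measure S) [IsProbabilityMeasure ρ],
      (∫ x, f x ∂ρ = ∫ t in Set.Ioc 0 1, ρ.real {a | t ≤ f a}) ∧
        IntegrableOn (fun t => ρ.real {a | t ≤ f a}) (Set.Ioc (0 : ℝ) 1) := by
    intro ρ _
    refine ⟨Integrable.integral_eq_integral_Ioc_meas_le ?_ (Eventually.of_forall h0)
      (Eventually.of_forall h1), ?_⟩
    · refine Integrable.of_bound hf.aestronglyMeasurable 1 (Eventually.of_forall fun x => ?_)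
      rw [Real.norm_of_nonneg (h0 x)]
      exact h1 x
    · have hanti : Antitone fun t => ρ.real {a | t ≤ f a} := fun s t hst =>
        measureReal_mono fun a (ha : t ≤ f a) => hst.trans ha
      refine Integrable.of_bound hanti.measurable.aestronglyMeasurable 1
        (Eventually.of_forall fun t => ?_)
      rw [Real.norm_of_nonneg measureReal_nonneg]
      exact measureReal_le_one
  rw [(key μ).1, (key ν).1, ← integral_sub (key μ).2 (key ν).2, ← Real.norm_eq_abs]
  simpa using norm_setIntegral_le_of_norm_le_const (μ := volume) (s := Set.Ioc (0 : ℝ) 1)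
    (f := fun t => μ.real {a | t ≤ f a} - ν.real {a | t ≤ f a})
    (C := c) (by simp) fun t _ => h {a | t ≤ f a} (hf measurableSet_Ici)

/-- A setwise uniform limit of probability measures is a probability measure. -/
theorem exists_measure_of_uniform_limit {ν : ℕ → Measure S} [∀ n, IsProbabilityMeasure (ν n)]
    {L : Set S → ℝ} {c : ℕ → ℝ} (hc : Tendsto c atTop (𝓝 0))
    (h : ∀ n A, MeasurableSet A → |(ν n).real A - L A| ≤ c n) :
    ∃ μ : Measure S, IsProbabilityMeasure μ ∧ ∀ A, MeasurableSet A → μ.real A = L A := by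
  have hlim : ∀ A, MeasurableSet A → Tendsto (fun n => (ν n).real A) atTop (𝓝 (L A)) := by
    intro A hA
    rw [tendsto_iff_norm_sub_tendsto_zero]
    exact squeeze_zero (fun _ => norm_nonneg _) (fun n => h n A hA) hc
  have hL0 : ∀ A, MeasurableSet A → 0 ≤ L A := fun A hA =>
    ge_of_tendsto' (hlim A hA) fun _ => measureReal_nonneg
  have hempty : L ∅ = 0 := tendsto_nhds_unique (hlim ∅ .empty) (by simp)
  have huniv : L Set.univ = 1 := tendsto_nhds_unique (hlim _ .univ) (by simp)
  have hsum : ∀ f : ℕ → Set S, (∀ i, MeasurableSet (f i)) → Pairwise (Function.onFun Disjoint f) →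
      HasSum (fun i => L (f i)) (L (⋃ i, f i)) := by
    intro f hf hd
    have hfin : ∀ n (s : Finset ℕ), (ν n).real (⋃ i ∈ s, f i) = ∑ i ∈ s, (ν n).real (f i) :=
      fun n s => measureReal_biUnion_finset (fun i _ j _ hij => hd hij) fun i _ => hf i
    have hfinL : ∀ s : Finset ℕ, L (⋃ i ∈ s, f i) = ∑ i ∈ s, L (f i) := fun s =>
      tendsto_nhds_unique (hlim _ (Finset.measurableSet_biUnion s fun i _ => hf i)) (by
        simp_rw [hfin]
        exact tendsto_finsetSum _ fun i _ => hlim _ (hf i))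
    -- Countable additivity is an exchange of limits. It is allowed because a finite partial sum is
    -- the measure of a finite union, so `c n` bounds the error uniformly in `s`.
    have hu : TendstoUniformly (fun n (s : Finset ℕ) => ∑ i ∈ s, (ν n).real (f i))
        (fun s => ∑ i ∈ s, L (f i)) atTop := by
      rw [Metric.tendstoUniformly_iff]
      intro ε hε
      filter_upwards [hc.eventually_lt_const hε] with n hn s
      rw [← hfin, ← hfinL, dist_comm, Real.dist_eq]
      exact (h n _ (Finset.measurableSet_biUnion s fun i _ => hf i)).trans_lt hn
    refine hu.tendsto_of_eventually_tendsto (Eventually.of_forall fun n => ?_)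
      (hlim _ (MeasurableSet.iUnion hf))
    have : Summable fun i => (ν n).real (f i) :=
      ENNReal.summable_toReal (by
        rw [← measure_iUnion hd hf]
        exact measure_ne_top _ _)
    convert! this.hasSum
    rw [measureReal_def, measure_iUnion hd hf, ENNReal.tsum_toReal_eq fun _ => measure_ne_top _ _]
    rfl
  let μ : Measure S := Measure.ofMeasurable (fun A _ => ENNReal.ofReal (L A)) (by simp [hempty])
    fun f hf hd => by
      rw [← (hsum f hf hd).tsum_eq,
        ENNReal.ofReal_tsum_of_nonneg (fun i => hL0 _ (hf i)) (hsum f hf hd).summable]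
  have hμ : ∀ A, MeasurableSet A → μ A = ENNReal.ofReal (L A) := fun A hA =>
    Measure.ofMeasurable_apply A hA
  refine ⟨μ, ⟨by rw [hμ _ .univ, huniv, ENNReal.ofReal_one]⟩, fun A hA => ?_⟩
  rw [measureReal_def, hμ A hA, ENNReal.toReal_ofReal (hL0 A hA)]

/-! ### The coupling operator on differences -/

/-- The common part `(p(x.1, u) ∧ p(x.2, u)) Λ_x(du)` of the two transition probabilities. -/
def commonPart (Q : Kernel S S) (x : S × S) : Measure S :=
  (refMeasure Q x).withDensity fun u => min (dens₁ Q x u) (dens₂ Q x u)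

section decomposition

variable (Q : Kernel S S) [IsMarkovKernel Q] (x : S × S)

omit [IsMarkovKernel Q] in
theorem commonPart_univ : commonPart Q x Set.univ = overlap Q x := by
  rw [commonPart, withDensity_apply _ .univ, Measure.restrict_univ, overlap]

instance : IsFiniteMeasure (commonPart Q x) :=
  ⟨by rw [commonPart_univ]; exact (overlap_le_one Q x).trans_lt ENNReal.one_lt_top⟩

theorem withDensity_dens₁ : (refMeasure Q x).withDensity (dens₁ Q x) = Q x.1 :=
  Measure.withDensity_rnDeriv_eq _ _
    (Measure.AbsolutelyContinuous.add_right Measure.AbsolutelyContinuous.rfl _)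

theorem withDensity_dens₂ : (refMeasure Q x).withDensity (dens₂ Q x) = Q x.2 :=
  Measure.withDensity_rnDeriv_eq _ _ (by
    rw [refMeasure, add_comm]
    exact Measure.AbsolutelyContinuous.add_right Measure.AbsolutelyContinuous.rfl _)

omit [IsMarkovKernel Q] in
theorem withDensity_sub_add_commonPart {g : S → ℝ≥0∞}
    (hle : ∀ u, min (dens₁ Q x u) (dens₂ Q x u) ≤ g u) :
    (refMeasure Q x).withDensity (fun u => g u - min (dens₁ Q x u) (dens₂ Q x u)) + commonPart Q x
      = (refMeasure Q x).withDensity g := by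
  rw [commonPart, ← withDensity_add_right _ ((measurable_dens₁ Q x).min (measurable_dens₂ Q x))]
  congr 1
  funext u
  exact tsub_add_cancel_of_le (hle u)

omit [IsMarkovKernel Q] in
/-- A probability measure that dominates the common part is the common part if the overlap is
complete. -/
theorem eq_commonPart_of_overlap_eq_one (h : overlap Q x = 1) {μ ν : Measure S}
    [IsProbabilityMeasure μ] (hμ : ν + commonPart Q x = μ) : μ = commonPart Q x := by
  have h1 : ν Set.univ + 1 = 0 + 1 := by
    rw [← h, ← commonPart_univ, ← Measure.add_apply, hμ, measure_univ, commonPart_univ, h, zero_add]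
  have h0 : ν = 0 := Measure.measure_univ_eq_zero.1 ((ENNReal.add_left_inj ENNReal.one_ne_top).1 h1)
  rw [← hμ, h0, zero_add]

theorem smul_withDensity_div {g : S → ℝ≥0∞} (h : overlap Q x ≠ 1) :
    (1 - overlap Q x) • (refMeasure Q x).withDensity (fun u => g u / (1 - overlap Q x))
      = (refMeasure Q x).withDensity g := by
  have h0 : 1 - overlap Q x ≠ 0 :=
    (tsub_pos_of_lt (lt_of_le_of_ne (overlap_le_one Q x) h)).ne'
  have ht : 1 - overlap Q x ≠ ∞ := ENNReal.sub_ne_top ENNReal.one_ne_top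
  rw [← withDensity_smul' _ _ ht]
  congr 1
  funext u
  exact ENNReal.mul_div_cancel h0 ht

/-- When the overlap is 1 the residual has weight 0, so its conventional value plays no role. -/
theorem smul_residual₁_add_commonPart :
    (1 - overlap Q x) • residual₁ Q x + commonPart Q x = Q x.1 := by
  have key := withDensity_sub_add_commonPart Q x (g := dens₁ Q x) fun u => min_le_left _ _
  rw [withDensity_dens₁] at key
  by_cases h : overlap Q x = 1
  · rw [h, tsub_self, zero_smul, zero_add, ← eq_commonPart_of_overlap_eq_one Q x h key]
  · rw [residual₁, if_neg h, smul_withDensity_div Q x h, key]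

theorem smul_residual₂_add_commonPart :
    (1 - overlap Q x) • residual₂ Q x + commonPart Q x = Q x.2 := by
  have key := withDensity_sub_add_commonPart Q x (g := dens₂ Q x) fun u => min_le_right _ _
  rw [withDensity_dens₂] at key
  by_cases h : overlap Q x = 1
  · rw [h, tsub_self, zero_smul, zero_add, ← eq_commonPart_of_overlap_eq_one Q x h key]
  · rw [residual₂, if_neg h, smul_withDensity_div Q x h, key]

/-- The two transition laws share the same `commonPart`, whose contributions cancel; the weighted
residuals that remain are exactly what `V` integrates against. -/
theorem couplingFun_sub {f : S → ℝ} (hf : Measurable f) {C : ℝ} (hC : ∀ s, ‖f s‖ ≤ C) :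
    couplingFun Q (fun y => ((f y.1 - f y.2 : ℝ) : ℂ)) x
      = ((∫ s, f s ∂(Q x.1) - ∫ s, f s ∂(Q x.2) : ℝ) : ℂ) := by
  have hi : ∀ (ρ : Measure S) [IsFiniteMeasure ρ], Integrable f ρ := fun ρ _ =>
    Integrable.of_bound hf.aestronglyMeasurable C (Eventually.of_forall hC)
  have ht : 1 - overlap Q x ≠ ∞ := ENNReal.sub_ne_top ENNReal.one_ne_top
  have e1 : ∫ s, f s ∂(Q x.1)
      = (1 - overlap Q x).toReal * ∫ s, f s ∂(residual₁ Q x) + ∫ s, f s ∂(commonPart Q x) := by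
    conv_lhs => rw [← smul_residual₁_add_commonPart Q x]
    rw [integral_add_measure ((hi _).smul_measure ht) (hi _), integral_smul_measure, smul_eq_mul]
  have e2 : ∫ s, f s ∂(Q x.2)
      = (1 - overlap Q x).toReal * ∫ s, f s ∂(residual₂ Q x) + ∫ s, f s ∂(commonPart Q x) := by
    conv_lhs => rw [← smul_residual₂_add_commonPart Q x]
    rw [integral_add_measure ((hi _).smul_measure ht) (hi _), integral_smul_measure, smul_eq_mul]
  have e3 : ∫ y, (f y.1 - f y.2) ∂((residual₁ Q x).prod (residual₂ Q x))
      = ∫ s, f s ∂(residual₁ Q x) - ∫ s, f s ∂(residual₂ Q x) := by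
    rw [integral_sub ((hi _).comp_fst _) ((hi _).comp_snd _), integral_fun_fst, integral_fun_snd]
    simp
  rw [couplingFun, integral_complex_ofReal, e3, e1, e2]
  push_cast
  ring

end decomposition

/-- The bounded measurable function `(s, t) ↦ f s - f t`. -/
def diffFun (f : S → ℝ) (hf : Measurable f) (h0 : ∀ s, 0 ≤ f s) (h1 : ∀ s, f s ≤ 1) :
    BddMeas (S × S) :=
  ⟨⟨fun y => ((f y.1 - f y.2 : ℝ) : ℂ), memℓp_infty ⟨1, by
      rintro _ ⟨y, rfl⟩
      simp only [Complex.norm_real, Real.norm_eq_abs, abs_le]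
      constructor <;> linarith [h0 y.1, h0 y.2, h1 y.1, h1 y.2]⟩⟩,
    Complex.measurable_ofReal.comp ((hf.comp measurable_fst).sub (hf.comp measurable_snd))⟩

theorem norm_diffFun_le (f : S → ℝ) (hf : Measurable f) (h0 : ∀ s, 0 ≤ f s) (h1 : ∀ s, f s ≤ 1) :
    ‖diffFun f hf h0 h1‖ ≤ 1 := by
  refine lp.norm_le_of_forall_le zero_le_one fun y => ?_
  change ‖((f y.1 - f y.2 : ℝ) : ℂ)‖ ≤ 1
  simp only [Complex.norm_real, Real.norm_eq_abs, abs_le]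
  constructor <;> linarith [h0 y.1, h0 y.2, h1 y.1, h1 y.2]

theorem real_comp_apply (κ : Kernel S S) [IsMarkovKernel κ] (ν : Measure S) {A : Set S}
    (hA : MeasurableSet A) : (κ ∘ₘ ν).real A = ∫ s, (κ s).real A ∂ν := by
  rw [measureReal_def, Measure.bind_apply hA κ.aemeasurable]
  exact (integral_toReal (κ.measurable_coe hA).aemeasurable
    (Eventually.of_forall fun s => measure_lt_top _ _)).symm

theorem measurable_real_apply (κ : Kernel S S) {A : Set S} (hA : MeasurableSet A) :
    Measurable fun s => (κ s).real A :=
  (κ.measurable_coe hA).ennreal_toReal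

/-! ### Powers of the coupling operator and iterates of the kernel -/

section powers

set_option synthInstance.maxHeartbeats 400000 in
instance (X : Type*) [MeasurableSpace X] : Monoid (BddMeas X →L[ℂ] BddMeas X) :=
  ContinuousLinearMap.monoidWithZero.toMonoid

variable (Q : Kernel S S) [IsMarkovKernel Q] (hQ : PreservesMeasurability Q)

theorem toFun_couplingOp_diffFun {f : S → ℝ} (hf : Measurable f) (h0 : ∀ s, 0 ≤ f s)
    (h1 : ∀ s, f s ≤ 1) (x : S × S) :
    toFun (couplingOp Q hQ (diffFun f hf h0 h1)) x
      = ((∫ s, f s ∂(Q x.1) - ∫ s, f s ∂(Q x.2) : ℝ) : ℂ) :=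
  couplingFun_sub Q x hf (C := 1) fun s => by
    rw [Real.norm_of_nonneg (h0 s)]
    exact h1 s

theorem bddMeas_ext {X : Type*} [MeasurableSpace X] {f g : BddMeas X}
    (h : ∀ x, toFun f x = toFun g x) : f = g :=
  Subtype.ext (Subtype.ext (funext h))

/-- The kernel `κ` is arbitrary so that the induction can replace it by `κ ∘ₖ Q`; it later carries
the `n % m` steps left over after blocks of length `m`. -/
theorem toFun_couplingOp_pow_diffFun (k : ℕ) (κ : Kernel S S) [IsMarkovKernel κ] {A : Set S}
    (hA : MeasurableSet A) (x : S × S) :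
    toFun ((couplingOp Q hQ ^ k) (diffFun (fun s => (κ s).real A) (measurable_real_apply κ hA)
        (fun _ => measureReal_nonneg) fun _ => measureReal_le_one)) x
      = (((κ ∘ₖ (Q ^ k)) x.1).real A - ((κ ∘ₖ (Q ^ k)) x.2).real A : ℝ) := by
  induction k generalizing κ with
  | zero =>
    have : κ ∘ₖ (Q ^ 0) = κ := by rw [pow_zero]; exact Kernel.comp_id κ
    rw [this]
    rfl
  | succ k ih =>
    have hassoc : κ ∘ₖ (Q ^ (k + 1)) = (κ ∘ₖ Q) ∘ₖ (Q ^ k) := by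
      rw [Kernel.comp_assoc, Nat.add_comm, Kernel.pow_add Q 1 k, pow_one]
    have hstep : couplingOp Q hQ (diffFun (fun s => (κ s).real A) (measurable_real_apply κ hA)
        (fun _ => measureReal_nonneg) fun _ => measureReal_le_one)
        = diffFun (fun s => ((κ ∘ₖ Q) s).real A) (measurable_real_apply _ hA)
          (fun _ => measureReal_nonneg) fun _ => measureReal_le_one := by
      refine bddMeas_ext fun y => ?_
      rw [toFun_couplingOp_diffFun, ← real_comp_apply κ _ hA, ← real_comp_apply κ _ hA,
        ← Kernel.comp_apply, ← Kernel.comp_apply]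
      rfl
    rw [hassoc, ← ih (κ ∘ₖ Q), pow_succ, mul_apply_eq_comp, hstep]

theorem abs_real_comp_pow_sub_le (k : ℕ) (κ : Kernel S S) [IsMarkovKernel κ] {A : Set S}
    (hA : MeasurableSet A) (s t : S) :
    |((κ ∘ₖ (Q ^ k)) s).real A - ((κ ∘ₖ (Q ^ k)) t).real A| ≤ ‖couplingOp Q hQ ^ k‖ := by
  have h := toFun_couplingOp_pow_diffFun Q hQ k κ hA (s, t)
  rw [← Real.norm_eq_abs, ← Complex.norm_real, ← h]
  exact (norm_toFun_le _ _).trans ((couplingOp Q hQ ^ k).le_of_opNorm_le_of_le le_rfl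
    (norm_diffFun_le _ _ _ _) |>.trans_eq (mul_one _))

end powers

/-- The difference of integrals is the average of `f s - f t` over `μ` and `ν`, taken one variable
at a time. -/
theorem abs_integral_sub_integral_le_of_oscillation {μ ν : Measure S} [IsProbabilityMeasure μ]
    [IsProbabilityMeasure ν] {f : S → ℝ} (hμ : Integrable f μ) (hν : Integrable f ν) {c : ℝ}
    (h : ∀ s t, |f s - f t| ≤ c) : |∫ s, f s ∂μ - ∫ s, f s ∂ν| ≤ c := by
  have h1 : ∀ t, |∫ s, f s ∂μ - f t| ≤ c := fun t => by
    have : ∫ s, f s ∂μ - f t = ∫ s, (f s - f t) ∂μ := by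
      rw [integral_sub hμ (integrable_const _)]; simp
    rw [this, ← Real.norm_eq_abs]
    simpa using norm_integral_le_of_norm_le_const (μ := μ) (f := fun s => f s - f t)
      (Eventually.of_forall fun s => h s t)
  have : ∫ s, f s ∂μ - ∫ s, f s ∂ν = ∫ t, (∫ s, f s ∂μ - f t) ∂ν := by
    rw [integral_sub (integrable_const _) hν]; simp
  rw [this, ← Real.norm_eq_abs]
  simpa using norm_integral_le_of_norm_le_const (μ := ν) (f := fun t => ∫ s, f s ∂μ - f t)
    (Eventually.of_forall h1)

/-- The laws of the chain at time `n` from any two initial distributions are setwise close. -/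
theorem abs_real_pow_comp_sub_le (P : Kernel S S) [IsMarkovKernel P] (m : ℕ)
    (hV : PreservesMeasurability (P ^ m)) (n : ℕ) (μ ν : Measure S) [IsProbabilityMeasure μ]
    [IsProbabilityMeasure ν] {A : Set S} (hA : MeasurableSet A) :
    |((P ^ n) ∘ₘ μ).real A - ((P ^ n) ∘ₘ ν).real A| ≤ ‖couplingOp (P ^ m) hV ^ (n / m)‖ := by
  have hi : ∀ (ρ : Measure S) [IsProbabilityMeasure ρ],
      Integrable (fun s => ((P ^ n) s).real A) ρ := fun ρ _ =>
    Integrable.of_bound (measurable_real_apply (P ^ n) hA).aestronglyMeasurable 1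
      (Eventually.of_forall fun s => by
        rw [Real.norm_of_nonneg measureReal_nonneg]
        exact measureReal_le_one)
  rw [real_comp_apply _ _ hA, real_comp_apply _ _ hA]
  refine abs_integral_sub_integral_le_of_oscillation (hi μ) (hi ν) fun s t => ?_
  have hn : P ^ n = (P ^ (n % m)) ∘ₖ ((P ^ m) ^ (n / m)) := by
    rw [← pow_mul, ← Kernel.pow_add, Nat.mod_add_div]
  have := abs_real_comp_pow_sub_le (P ^ m) hV (n / m) (P ^ (n % m)) hA s t
  rwa [← hn] at this

/-! ### Gelfand's formula on the space of bounded measurable functions -/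

/-- Norm limits are pointwise limits, hence measurable. This yields the completeness that Gelfand's
formula requires. -/
theorem isClosed_bddMeas (X : Type*) [MeasurableSpace X] :
    IsClosed (BddMeas X : Set (lp (fun _ : X => ℂ) ∞)) := by
  refine isClosed_of_closure_subset fun f hf => ?_
  obtain ⟨u, hu, hlim⟩ := mem_closure_iff_seq_limit.1 hf
  refine measurable_of_tendsto_metrizable (f := fun n x => u n x) hu ?_
  rw [tendsto_pi_nhds]
  intro x
  rw [tendsto_iff_norm_sub_tendsto_zero] at hlim ⊢
  exact squeeze_zero (fun _ => norm_nonneg _)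
    (fun n => lp.norm_apply_le_norm (by simp) (u n - f) x) hlim

instance (X : Type*) [MeasurableSpace X] : CompleteSpace (BddMeas X) :=
  (isClosed_bddMeas X).completeSpace_coe

theorem eventually_norm_pow_le {A : Type*} [NormedRing A] [NormedAlgebra ℂ A] [CompleteSpace A]
    (a : A) {ρ : ℝ} (hρ : spectralRadius ℂ a < ENNReal.ofReal ρ) :
    ∀ᶠ n : ℕ in atTop, ‖a ^ n‖ ≤ ρ ^ n := by
  have hρ0 : 0 < ρ := ENNReal.ofReal_pos.1 (bot_le.trans_lt hρ)
  filter_upwards [(spectrum.pow_norm_pow_one_div_tendsto_nhds_spectralRadius a).eventually_lt_const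
    hρ, eventually_gt_atTop 0] with n hn hn0
  have h := ((ENNReal.ofReal_lt_ofReal_iff hρ0).1 hn).le
  have hn' : (n : ℝ) ≠ 0 := by positivity
  calc ‖a ^ n‖ = (‖a ^ n‖ ^ (1 / n : ℝ)) ^ n := by
        rw [← Real.rpow_natCast, ← Real.rpow_mul (norm_nonneg _), one_div_mul_cancel hn',
          Real.rpow_one]
    _ ≤ ρ ^ n := pow_le_pow_left₀ (by positivity) h n

theorem eventually_norm_couplingOp_pow_le (Q : Kernel S S) [IsMarkovKernel Q]
    (hQ : PreservesMeasurability Q) {ρ : ℝ}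
    (hρ : spectralRadius ℂ (couplingOp Q hQ) < ENNReal.ofReal ρ) :
    ∀ᶠ n : ℕ in atTop, ‖couplingOp Q hQ ^ n‖ ≤ ρ ^ n :=
  eventually_norm_pow_le (couplingOp Q hQ) hρ

/-- A sequence that is eventually bounded by `ρ ^ k` is bounded by `C * q ^ n` along `k = n / m`. -/
theorem exists_geometric_bound_div {u : ℕ → ℝ} {ρ : ℝ} (h0 : 0 < ρ) (h1 : ρ < 1)
    (hu : ∀ᶠ k in atTop, u k ≤ ρ ^ k) {m : ℕ} (hm : 1 ≤ m) :
    ∃ C q : ℝ, 0 ≤ q ∧ q < 1 ∧ ∀ n, u (n / m) ≤ C * q ^ n := by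
  obtain ⟨N, hN⟩ := eventually_atTop.1 hu
  have hm0 : (m : ℝ) ≠ 0 := by positivity
  -- The sum covers the finitely many `k < N`; the summand 1 covers the tail.
  set D : ℝ := 1 + ∑ k ∈ Finset.range N, |u k| / ρ ^ k with hD
  have hD1 : 1 ≤ D := by
    rw [hD]
    have : 0 ≤ ∑ k ∈ Finset.range N, |u k| / ρ ^ k := Finset.sum_nonneg fun k _ => by positivity
    linarith
  have hb : ∀ k, u k ≤ D * ρ ^ k := by
    intro k
    have hk : 0 < ρ ^ k := by positivity
    rcases le_or_gt N k with h | h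
    · exact (hN k h).trans (le_mul_of_one_le_left hk.le hD1)
    · have : |u k| / ρ ^ k ≤ D := by
        have := Finset.single_le_sum (f := fun k => |u k| / ρ ^ k) (fun k _ => by positivity)
          (Finset.mem_range.2 h)
        linarith
      exact (le_abs_self _).trans ((div_le_iff₀ hk).1 this)
  -- The factor `1 / ρ` pays for rounding: `n / m` in ℕ is at least the real quotient minus 1.
  refine ⟨D / ρ, ρ ^ (1 / m : ℝ), by positivity,
    Real.rpow_lt_one h0.le h1 (by positivity), fun n => (hb _).trans ?_⟩
  rw [div_mul_eq_mul_div, mul_div_assoc]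
  refine mul_le_mul_of_nonneg_left ?_ (by linarith)
  rw [le_div_iff₀ h0, ← pow_succ, ← Real.rpow_natCast, ← Real.rpow_natCast, ← Real.rpow_mul h0.le]
  refine Real.rpow_le_rpow_of_exponent_ge h0 h1.le ?_
  rw [one_div_mul_eq_div, div_le_iff₀ (by positivity)]
  exact_mod_cast (Nat.lt_mul_of_div_lt (Nat.lt_succ_self (n / m)) hm).le

/-! ### The invariant probability measure -/

theorem comp_pow_of_invariant {P : Kernel S S} {μ : Measure S} (h : Kernel.Invariant P μ) (n : ℕ) :
    (P ^ n) ∘ₘ μ = μ := by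
  induction n with
  | zero => rw [pow_zero]; exact Measure.id_comp
  | succ n ih =>
    rw [Kernel.pow_add, ← Measure.comp_assoc, pow_one]
    exact (congrArg (fun ν => (P ^ n) ∘ₘ ν) h).trans ih

/-- If the laws of the chain forget the initial distribution uniformly, there is exactly one
invariant probability measure. -/
theorem existsUnique_invariant [Nonempty S] (P : Kernel S S) [IsMarkovKernel P] {c : ℕ → ℝ}
    (hc : Tendsto c atTop (𝓝 0))
    (h : ∀ (n : ℕ) (μ ν : Measure S) [IsProbabilityMeasure μ] [IsProbabilityMeasure ν] (A : Set S),
      MeasurableSet A → |((P ^ n) ∘ₘ μ).real A - ((P ^ n) ∘ₘ ν).real A| ≤ c n) :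
    ∃! μ : Measure S, IsProbabilityMeasure μ ∧ Kernel.Invariant P μ := by
  have eq_of : ∀ (μ ν : Measure S) [IsProbabilityMeasure μ] [IsProbabilityMeasure ν],
      (∀ A, MeasurableSet A → ∃ d : ℕ → ℝ, Tendsto d atTop (𝓝 0) ∧
        ∀ n, |μ.real A - ν.real A| ≤ d n) → μ = ν := by
    intro μ ν _ _ hd
    ext A hA
    obtain ⟨d, hd0, hd⟩ := hd A hA
    have h0 : |μ.real A - ν.real A| ≤ 0 := ge_of_tendsto' hd0 hd
    have h1 := sub_eq_zero.1 (abs_nonpos_iff.1 h0)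
    rwa [measureReal_def, measureReal_def,
      ENNReal.toReal_eq_toReal_iff' (measure_ne_top _ _) (measure_ne_top _ _)] at h1
  obtain ⟨x⟩ := ‹Nonempty S›
  -- The law at time `n + l` from `x` is the law at time `n` from the initial law `(P ^ l) x`.
  have hstep : ∀ n l A, MeasurableSet A →
      |((P ^ n) x).real A - ((P ^ (n + l)) x).real A| ≤ c n := by
    intro n l A hA
    have := h n (Measure.dirac x) ((P ^ l) x) A hA
    rwa [Measure.dirac_bind (P ^ n).measurable, ← Kernel.comp_apply, ← Kernel.pow_add] at this
  have hconv : ∀ A, MeasurableSet A → ∃ L, Tendsto (fun n => ((P ^ n) x).real A) atTop (𝓝 L) := by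
    intro A hA
    refine cauchySeq_tendsto_of_complete (cauchySeq_of_le_tendsto_0' c (fun n k hnk => ?_) hc)
    obtain ⟨l, rfl⟩ := Nat.exists_eq_add_of_le hnk
    exact hstep n l A hA
  choose! L hL using hconv
  have hclose : ∀ n A, MeasurableSet A → |((P ^ n) x).real A - L A| ≤ c n := by
    intro n A hA
    have hl : Tendsto (fun l => ((P ^ (n + l)) x).real A) atTop (𝓝 (L A)) := by
      simpa only [Nat.add_comm n] using (tendsto_add_atTop_iff_nat n).2 (hL A hA)
    exact le_of_tendsto' (tendsto_const_nhds.sub hl).abs fun l => hstep n l A hA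
  obtain ⟨μ, hμ, hμL⟩ := exists_measure_of_uniform_limit (ν := fun n => (P ^ n) x) hc hclose
  have hclose' : ∀ n A, MeasurableSet A → |((P ^ n) x).real A - μ.real A| ≤ c n :=
    fun n A hA => by rw [hμL A hA]; exact hclose n A hA
  refine ⟨μ, ⟨hμ, ?_⟩, ?_⟩
  · have : IsProbabilityMeasure (P ∘ₘ μ) := inferInstance
    refine eq_of (P ∘ₘ μ) μ fun A hA => ⟨fun n => c n + c (n + 1), ?_, fun n => ?_⟩
    · simpa using hc.add ((tendsto_add_atTop_iff_nat 1).2 hc)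
    -- Invariance: one more step sends `(P ^ n) x` to `(P ^ (n + 1)) x`, which is setwise close both
    -- to `P ∘ₘ μ` and to `μ`.
    · have h1 := abs_integral_sub_integral_le (hclose' n) (measurable_real_apply P hA)
        (fun _ => measureReal_nonneg) fun _ => measureReal_le_one
      rw [← real_comp_apply P _ hA, ← real_comp_apply P _ hA, ← Kernel.comp_apply] at h1
      have h2 := hclose' (n + 1) A hA
      have e : P ^ (n + 1) = P ∘ₖ (P ^ n) := by rw [Nat.add_comm, Kernel.pow_add, pow_one]
      rw [← e, abs_sub_comm] at h1
      exact (abs_sub_le _ _ _).trans (add_le_add h1 h2)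
  · rintro ν ⟨hν, hνP⟩
    refine eq_of ν μ fun A hA => ⟨fun n => c n + c n, by simpa using hc.add hc, fun n => ?_⟩
    have h1 := h n ν (Measure.dirac x) A hA
    rw [comp_pow_of_invariant hνP, Measure.dirac_bind (P ^ n).measurable] at h1
    exact (abs_sub_le _ _ _).trans (add_le_add h1 (hclose' n A hA))

end

end MarkovCoupling

/-! ### The theorem -/

open MarkovCoupling in
theorem mainTheorem7 {S : Type*} [MeasurableSpace S] [Nonempty S]
    (P : Kernel S S) [IsMarkovKernel P] (m : ℕ) (hm : 1 ≤ m)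
    (hV : PreservesMeasurability (P ^ m))
    (hr : spectralRadius ℂ (couplingOp (P ^ m) hV) < 1) :
    (∃! μ : Measure S, IsProbabilityMeasure μ ∧ Kernel.Invariant P μ) ∧
    ∀ (μ : Measure S) [IsProbabilityMeasure μ], Kernel.Invariant P μ →
      (∀ (μ₀ : Measure S) [IsProbabilityMeasure μ₀],
        ∃ C q : ℝ, 0 ≤ q ∧ q < 1 ∧ ∀ n : ℕ, tvNorm ((P ^ n) ∘ₘ μ₀) μ ≤ C * q ^ n) ∧
      ∀ (x : S) (ε : ℝ), 0 < ε → ∃ N : ℕ, ∀ n : ℕ, N ≤ n →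
        tvNorm ((P ^ n) x) μ
          ≤ ((spectralRadius ℂ (couplingOp (P ^ m) hV)).toReal + ε) ^ (n / m) := by
  have hbound := fun n (μ ν : Measure S) [IsProbabilityMeasure μ] [IsProbabilityMeasure ν]
    (A : Set S) (hA : MeasurableSet A) => abs_real_pow_comp_sub_le P m hV n μ ν hA
  have hgelfand := fun ρ => eventually_norm_couplingOp_pow_le (P ^ m) hV (ρ := ρ)
  set r := spectralRadius ℂ (couplingOp (P ^ m) hV) with hr_def
  have hr_top : r ≠ ∞ := (hr.trans ENNReal.one_lt_top).ne
  have hrho : ∀ ρ : ℝ, r.toReal < ρ → ∀ᶠ k in atTop, ‖couplingOp (P ^ m) hV ^ k‖ ≤ ρ ^ k :=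
    fun ρ h => hgelfand ρ ((ENNReal.lt_ofReal_iff_toReal_lt hr_top).2 h)
  have hr1 : r.toReal < 1 := by
    simpa using (ENNReal.toReal_lt_toReal hr_top ENNReal.one_ne_top).2 hr
  have hr0 : 0 ≤ r.toReal := ENNReal.toReal_nonneg
  obtain ⟨ρ, hrρ, hρ1⟩ := exists_between hr1
  obtain ⟨C, q, hq0, hq1, hCq⟩ :=
    exists_geometric_bound_div (hr0.trans_lt hrρ) hρ1 (hrho ρ hrρ) hm
  have htv : ∀ (μ : Measure S) [IsProbabilityMeasure μ], Kernel.Invariant P μ →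
      ∀ (ν : Measure S) [IsProbabilityMeasure ν] (n : ℕ),
        tvNorm ((P ^ n) ∘ₘ ν) μ ≤ 2 * ‖couplingOp (P ^ m) hV ^ (n / m)‖ := by
    intro μ _ hμ ν _ n
    refine tvNorm_le_two_mul fun A hA => ?_
    have := hbound n ν μ A hA
    rwa [comp_pow_of_invariant hμ] at this
  refine ⟨existsUnique_invariant P (c := fun n => C * q ^ n) ?_ fun n μ ν _ _ A hA =>
    (hbound n μ ν A hA).trans (hCq n), fun μ _ hμ => ⟨fun μ₀ _ => ?_, fun x ε hε => ?_⟩⟩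
  · simpa using (tendsto_pow_atTop_nhds_zero_of_lt_one hq0 hq1).const_mul C
  · refine ⟨2 * C, q, hq0, hq1, fun n => (htv μ hμ μ₀ n).trans ?_⟩
    rw [mul_assoc]
    exact mul_le_mul_of_nonneg_left (hCq n) zero_le_two
  -- Gelfand's bound is used at `r + ε / 2`, so that the ratio of the two geometric sequences
  -- eventually exceeds the factor 2 from total variation.
  · have hlt : r.toReal + ε / 2 < r.toReal + ε := by linarith
    have hpos : 0 < r.toReal + ε / 2 := by positivity
    have hratio : Tendsto (fun k : ℕ => ((r.toReal + ε) / (r.toReal + ε / 2)) ^ k) atTop atTop :=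
      tendsto_pow_atTop_atTop_of_one_lt ((one_lt_div hpos).2 hlt)
    have hev : ∀ᶠ k : ℕ in atTop, 2 * ‖couplingOp (P ^ m) hV ^ k‖ ≤ (r.toReal + ε) ^ k := by
      filter_upwards [hrho (r.toReal + ε / 2) (by linarith), hratio.eventually_ge_atTop 2]
        with k h1 h2
      rw [div_pow, le_div_iff₀ (pow_pos hpos k)] at h2
      exact (mul_le_mul_of_nonneg_left h1 zero_le_two).trans h2
    obtain ⟨N, hN⟩ := eventually_atTop.1
      ((Nat.tendsto_div_const_atTop (Nat.one_le_iff_ne_zero.1 hm)).eventually hev)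
    refine ⟨N, fun n hn => ?_⟩
    have := htv μ hμ (Measure.dirac x) n
    simp only [Measure.dirac_bind (P ^ n).measurable] at this
    exact this.trans (hN n hn)
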